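/- Let $\mathcal X,\mathcal Y$ be finite-dimensional real inner product spaces, and let $A:\mathcal X\to\mathcal Y$ be linear with adjoint $A^*$. A gauge is a convex function with values in $[0,+\infty]$ that is positively homogeneous ($\kappa(tx)=t\kappa(x)$ for $t>0$) and vanishes at the origin; it is closed if it is lower semicontinuous. The domain of a gauge $\kappa$ is $\operatorname{dom}\kappa=\{x\mid\kappa(x)<\infty\}$, and its polar is $$\kappa^\circ(y)=\inf\{\mu>0\mid \langle x,y\rangle\le\mu\,\kappa(x)\ \text{for all }x\},\qquad \inf\emptyset=+\infty .$$ The antipolar of a set $D$ is $D'=\{y\mid\langle y,x\rangle\ge1\ \text{for all }x\in D\}$, and $\operatorname{ri}$ denotes relative interior. Let $\kappa$ be a closed gauge on $\mathcal X$ and $\rho$ a closed gauge on $\mathcal Y$, let $b\in\mathcal Y$ and $0\le\sigma<\rho(b)$, and if $\sigma=0$ assume in addition that $\rho^{-1}(0)=\{0\}$. Put $\mathcal C_0=\{u\in\mathcal Y\mid\rho(b-u)\le\sigma\}$ and assume $$\operatorname{ri}\operatorname{dom}\kappa\cap A^{-1}\operatorname{ri}\mathcal C_0\ne\emptyset\qquad\text{and}\qquad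 \operatorname{ri}\operatorname{dom}\kappa^\circ\cap A^*\operatorname{ri}\mathcal C_0'\ne\emptyset .$$ Then the problem $$(\mathrm P_\rho)\qquad \min_{x\in\mathcal X}\ \kappa(x)\quad\text{subject to}\quad \rho(b-Ax)\le\sigma$$ and its gauge dual $$(\mathrm D_\rho)\qquad \min_{y\in\mathcal Y}\ \kappa^\circ(A^*y)\quad\text{subject to}\quad \langle b,y\rangle-\sigma\rho^\circ(y)\ge1$$ both attain their optimal values, and the product of these two values is $1$. -/

import Mathlib

open Set
open scoped NNReal ENNReal RealInnerProductSpace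

noncomputable section

namespace GaugeDuality

variable {E F : Type*} [NormedAddCommGroup E] [InnerProductSpace ℝ E]
  [NormedAddCommGroup F] [InnerProductSpace ℝ F]

/-- A gauge: a nonnegative, positively homogeneous convex function that vanishes at the origin.
The values lie in `[0, ∞]`, which encodes nonnegativity and the admissible value `+∞`. -/
structure IsGauge (κ : E → ℝ≥0∞) : Prop where
  map_zero : κ 0 = 0
  map_smul : ∀ t : ℝ≥0, 0 < t → ∀ x : E, κ (t • x) = t * κ x
  convex : ConvexOn ℝ≥0 univ κ

/-- A gauge is closed if it is lower semicontinuous, i.e. if its epigraph is closed. -/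
def IsClosedGauge (κ : E → ℝ≥0∞) : Prop :=
  IsGauge κ ∧ LowerSemicontinuous κ

/-- The effective domain `{x | κ x < ∞}`. -/
def dom (κ : E → ℝ≥0∞) : Set E := {x | κ x < ∞}

/-- The polar gauge `κ°(y) = inf {μ > 0 | ⟨x, y⟩ ≤ μ κ(x) for all x}`, with `inf ∅ = ∞`;
the parameter `μ` is real, and the inequality is one between extended reals. -/
def polar (κ : E → ℝ≥0∞) (y : E) : ℝ≥0∞ :=
  ⨅ μ ∈ {μ : ℝ≥0 | 0 < μ ∧ ∀ x : E, ((⟪x, y⟫ : ℝ) : EReal) ≤ ((μ * κ x : ℝ≥0∞) : EReal)},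
    (μ : ℝ≥0∞)

/-- The antipolar `C' = {y | ⟨y, x⟩ ≥ 1 for all x ∈ C}`. -/
def antipolar (C : Set E) : Set E := {y | ∀ x ∈ C, (1 : ℝ) ≤ ⟪y, x⟫}

/-- The set `C₀ = {u | ρ(b - u) ≤ σ}`. -/
def residualSet (ρ : F → ℝ≥0∞) (b : F) (σ : ℝ≥0) : Set F := {u | ρ (b - u) ≤ σ}

/-- The feasible set `C = {x | ρ(b - A x) ≤ σ}` of the primal problem. -/
def primalFeasible (A : E →ₗ[ℝ] F) (ρ : F → ℝ≥0∞) (b : F) (σ : ℝ≥0) : Set E :=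
  {x | ρ (b - A x) ≤ σ}

/-- The feasible set `{y | ⟨b, y⟩ - σ ρ°(y) ≥ 1}` of the gauge dual problem; the difference is
taken in the extended reals, so `y` is infeasible when `σ ρ°(y) = ∞`. -/
def dualFeasible (ρ : F → ℝ≥0∞) (b : F) (σ : ℝ≥0) : Set F :=
  {y | (1 : EReal) ≤ ((⟪b, y⟫ : ℝ) : EReal) - ((σ * polar ρ y : ℝ≥0∞) : EReal)}

/-- The optimal value of the primal problem: minimize `κ x` subject to `ρ(b - A x) ≤ σ`. -/
def primalValue (κ : E → ℝ≥0∞) (A : E →ₗ[ℝ] F) (ρ : F → ℝ≥0∞) (b : F) (σ : ℝ≥0) : ℝ≥0∞ :=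
  ⨅ x ∈ primalFeasible A ρ b σ, κ x

/-- The optimal value of the gauge dual problem: minimize `κ°(A* y)` subject to
`⟨b, y⟩ - σ ρ°(y) ≥ 1`. -/
def dualValue [FiniteDimensional ℝ E] [FiniteDimensional ℝ F]
    (κ : E → ℝ≥0∞) (A : E →ₗ[ℝ] F) (ρ : F → ℝ≥0∞) (b : F) (σ : ℝ≥0) : ℝ≥0∞ :=
  ⨅ y ∈ dualFeasible ρ b σ, polar κ (LinearMap.adjoint A y)

end GaugeDuality

end

/-! If `A x ∈ C₀` and `y ∈ C₀'`, then `1 ≤ ⟨A x, y⟩ = ⟨x, A* y⟩ ≤ κ(x) κ°(A* y)`: this is weak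
duality. The relative interior points make both values `p`, `d` finite, hence also nonzero.

Equality and attainment come from using `exists_linear_separation` twice. Applied to `κ` and `C₀`,
it gives `z` with `⟨z, A x⟩ ≤ κ(x)` everywhere and `⟨z, ·⟩ ≥ p` on `C₀`, so `z / p` is dual feasible
with value at most `1 / p`. Applied to `κ°` and `C₀'`, it gives `x` with `⟨x, ·⟩ ≤ κ°` and `⟨x, A*
·⟩ ≥ d` on `C₀'`. Closedness of `κ` turns the first into `κ(x) ≤ 1`; the bipolar theorem for `C₀''`
turns the second into primal feasibility of `x / d`, up to shrinking.

The separation lemma is algebraic: relative interiors enter only because their points can be pushed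
slightly away from any point of the set. -/

open Set
open scoped NNReal ENNReal RealInnerProductSpace

namespace GaugeDuality

/-! ### Algebraic Hahn–Banach separation and Fenchel duality -/

section Algebra

variable {X Y W : Type*} [AddCommGroup X] [Module ℝ X] [AddCommGroup Y] [Module ℝ Y]
  [AddCommGroup W] [Module ℝ W]

/-- A convex set whose points can all be slightly reflected through the origin absorbs its span. -/
theorem exists_smul_mem_of_mem_span {D : Set W} (hD : Convex ℝ D) (h0 : (0 : W) ∈ D)
    (hneg : ∀ w ∈ D, ∃ ε : ℝ, 0 < ε ∧ -(ε • w) ∈ D) {w : W} (hw : w ∈ Submodule.span ℝ D) :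
    ∃ t : ℝ, 0 < t ∧ t • w ∈ D := by
  have hpos : ∀ (c : ℝ) (w : W), 0 < c → (∃ t : ℝ, 0 < t ∧ t • w ∈ D) →
      ∃ t : ℝ, 0 < t ∧ t • c • w ∈ D := by
    rintro c w hc ⟨t, ht, h⟩
    refine ⟨t / c, by positivity, ?_⟩
    rwa [smul_smul, div_mul_cancel₀ _ hc.ne']
  induction hw using Submodule.span_induction with
  | mem x hx => exact ⟨1, one_pos, by simpa using hx⟩
  | zero => exact ⟨1, one_pos, by simpa using h0⟩
  | add x y _ _ hx hy =>
    obtain ⟨s, hs, hx⟩ := hx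
    obtain ⟨t, ht, hy⟩ := hy
    -- This factor makes the multiple of `x + y` a convex combination of `s • x` and `t • y`.
    refine ⟨s * t / (s + t), by positivity, ?_⟩
    have := hD hx hy (a := t / (s + t)) (b := s / (s + t)) (by positivity) (by positivity)
      (by field_simp; ring)
    convert this using 1
    rw [smul_add, smul_smul, smul_smul]
    congr 2 <;> ring
  | smul c x _ hx =>
    rcases lt_trichotomy c 0 with hc | rfl | hc
    · obtain ⟨t, ht, hx⟩ := hx
      obtain ⟨ε, hε, hn⟩ := hneg _ hx
      have := hpos (-c) (-x) (by linarith) ⟨ε * t, by positivity, by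
        rwa [smul_neg, mul_smul]⟩
      simpa using this
    · exact ⟨1, one_pos, by simpa using h0⟩
    · exact hpos c x hc hx

/-- A convex set in `W × ℝ` lying above height `v` over the origin is supported by an affine
function of height `v` at the origin, if its projection to `W` absorbs its span. -/
theorem exists_linear_minorant {Φ : Set (W × ℝ)} (hΦ : Convex ℝ Φ) {v : ℝ}
    (hv : ∀ r, ((0 : W), r) ∈ Φ → v ≤ r)
    (habs : ∀ w ∈ Submodule.span ℝ (Prod.fst '' Φ), ∃ t : ℝ, 0 < t ∧ t • w ∈ Prod.fst '' Φ) :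
    ∃ z : W →ₗ[ℝ] ℝ, ∀ p ∈ Φ, v + z p.1 ≤ p.2 := by
  set V := Submodule.span ℝ (Prod.fst '' Φ) with hV
  -- `K` consists of the positive multiples of `Φ - (0, v)`. The functional `(0, r) ↦ r` is
  -- nonnegative on `K ∩ ({0} × ℝ)` by `hv`, so Riesz extension applies once the origin is adjoined.
  let K : ConvexCone ℝ (V × ℝ) :=
    { carrier := {p | ∃ t : ℝ, 0 < t ∧ (t • (p.1 : W), t * p.2 + v) ∈ Φ}
      smul_mem' := by
        rintro c hc ⟨w, r⟩ ⟨t, ht, h⟩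
        refine ⟨t / c, by positivity, ?_⟩
        convert h using 2
        · simp [smul_smul, div_mul_cancel₀ _ hc.ne']
        · simp only [Prod.smul_mk, smul_eq_mul]; field_simp
      add_mem' := by
        rintro ⟨w, r⟩ ⟨s, hs, h⟩ ⟨w', r'⟩ ⟨t, ht, h'⟩
        refine ⟨s * t / (s + t), by positivity, ?_⟩
        have := hΦ h h' (a := t / (s + t)) (b := s / (s + t)) (by positivity) (by positivity)
          (by field_simp; ring)
        convert this using 1
        ext
        · simp only [Prod.mk_add_mk, Submodule.coe_add, Prod.smul_mk, smul_add, smul_smul]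
          congr 2 <;> ring
        · simp only [Prod.mk_add_mk, Prod.smul_mk, smul_eq_mul]
          field_simp
          ring }
  have hK : ∀ p : V × ℝ, p ∈ K ↔ ∃ t : ℝ, 0 < t ∧ (t • (p.1 : W), t * p.2 + v) ∈ Φ :=
    fun _ => Iff.rfl
  let f : (V × ℝ) →ₗ.[ℝ] ℝ :=
    { domain := LinearMap.ker (LinearMap.fst ℝ V ℝ)
      toFun := (LinearMap.snd ℝ V ℝ).comp (Submodule.subtype _) }
  let P : PointedCone ℝ (V × ℝ) :=
    { carrier := {p | p = 0 ∨ p ∈ K}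
      zero_mem' := Or.inl rfl
      add_mem' := by
        rintro x y (rfl | hx) (rfl | hy)
        · exact Or.inl (add_zero 0)
        · exact Or.inr (by rwa [zero_add])
        · exact Or.inr (by rwa [add_zero])
        · exact Or.inr (K.add_mem' hx hy)
      smul_mem' := by
        rintro ⟨c, hc⟩ x (rfl | hx)
        · exact Or.inl (smul_zero _)
        · rcases hc.eq_or_lt with rfl | hc
          · exact Or.inl (zero_smul ℝ x)
          · exact Or.inr (K.smul_mem' hc hx) }
  obtain ⟨g, hgf, hg⟩ := riesz_extension P f
    (by
      rintro ⟨⟨w, r⟩, hw⟩ h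
      rcases h with h | h
      · exact (congrArg Prod.snd h).ge
      obtain ⟨t, ht, h⟩ := (hK _).1 h
      have hw : w = 0 := hw
      subst hw
      have := hv (t * r + v) (by simpa using h)
      change 0 ≤ r
      have : 0 ≤ t * r := by linarith
      exact nonneg_of_mul_nonneg_right this ht)
    (by
      rintro ⟨w, c⟩
      obtain ⟨t, ht, ⟨w', r⟩, hp, hpw⟩ := habs w w.2
      refine ⟨⟨(0, (r - v) / t - c), by simp [f]⟩, Or.inr ((hK _).2 ⟨t, ht, ?_⟩)⟩
      convert hp using 2
      · simpa using hpw.symm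
      · simp only [Prod.mk_add_mk]; field_simp; ring)
  have hg1 : ∀ r : ℝ, g (0, r) = r := fun r => hgf ⟨(0, r), by simp [f]⟩
  obtain ⟨z, hz⟩ := LinearMap.exists_extend (-(g.comp (LinearMap.inl ℝ V ℝ)))
  refine ⟨z, fun p hp => ?_⟩
  have hpV : p.1 ∈ V := Submodule.subset_span ⟨p, hp, rfl⟩
  have h1 := hg (⟨p.1, hpV⟩, p.2 - v) (Or.inr ((hK _).2 ⟨1, one_pos, by simpa using hp⟩))
  have h2 : z p.1 = -g (⟨p.1, hpV⟩, 0) := by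
    simpa using LinearMap.congr_fun hz ⟨p.1, hpV⟩
  have h3 : g (⟨p.1, hpV⟩, p.2 - v) = g (⟨p.1, hpV⟩, 0) + (p.2 - v) := by
    rw [← hg1 (p.2 - v), ← map_add, hg1]; simp
  linarith

/-- Fenchel duality for minimizing a sublinear function over a convex set, with attainment in the
dual: the constraint qualification is expressed by reflections through a common point. -/
theorem exists_linear_separation {κ : X → ℝ≥0∞} (hκ0 : κ 0 = 0)
    (hadd : ∀ x y, κ (x + y) ≤ κ x + κ y) (hsmul : ∀ t : ℝ≥0, 0 < t → ∀ x, κ (t • x) ≤ t * κ x)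
    {C : Set Y} (hC : Convex ℝ C) (L : X →ₗ[ℝ] W) (M : Y →ₗ[ℝ] W) {x₀ : X} {u₀ : Y}
    (hx₀ : κ x₀ < ∞) (hu₀ : u₀ ∈ C) (hxu : L x₀ = M u₀)
    (hx : ∀ x, κ x < ∞ → ∃ ε : ℝ, 0 < ε ∧ ∀ δ, 0 ≤ δ → δ ≤ ε → κ (x₀ + δ • (x₀ - x)) < ∞)
    (hu : ∀ u ∈ C, ∃ ε : ℝ, 0 < ε ∧ ∀ δ, 0 ≤ δ → δ ≤ ε → u₀ + δ • (u₀ - u) ∈ C)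
    {v : ℝ} (hv : ∀ x, ∀ u ∈ C, L x = M u → ENNReal.ofReal v ≤ κ x) :
    ∃ z : W →ₗ[ℝ] ℝ, (∀ x, ∀ k : ℝ≥0, κ x = k → z (L x) ≤ k) ∧ ∀ u ∈ C, v ≤ z (M u) := by
  -- Costs are recorded against the violation of the constraint `L x = M u`; over violation `0` they
  -- are at least `v`.
  let Φ : Set (W × ℝ) := {p | ∃ x, ∃ u ∈ C, ∃ k : ℝ≥0, κ x ≤ k ∧ p = (L x - M u, (k : ℝ))}
  have hdom : ∀ x, ∀ u ∈ C, κ x < ∞ → L x - M u ∈ Prod.fst '' Φ := fun x u huC hxf =>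
    ⟨(L x - M u, ((κ x).toNNReal : ℝ)), ⟨x, u, huC, _, by rw [ENNReal.coe_toNNReal hxf.ne], rfl⟩,
      rfl⟩
  have hΦ : Convex ℝ Φ := by
    rw [convex_iff_forall_pos]
    rintro _ ⟨x, u, huC, k, hk, rfl⟩ _ ⟨x', u', hu', k', hk', rfl⟩ a c ha hc hac
    lift a to ℝ≥0 using ha.le
    lift c to ℝ≥0 using hc.le
    refine ⟨(a : ℝ) • x + (c : ℝ) • x', (a : ℝ) • u + (c : ℝ) • u', hC huC hu' ha.le hc.le hac,
      a * k + c * k', ?_, ?_⟩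
    · have h1 := hsmul a (by exact_mod_cast ha) x
      have h2 := hsmul c (by exact_mod_cast hc) x'
      refine (hadd _ _).trans ?_
      push_cast
      exact add_le_add (h1.trans (by gcongr)) (h2.trans (by gcongr))
    · ext
      · simp only [Prod.smul_mk, Prod.mk_add_mk, map_add, map_smul, smul_sub]; abel
      · simp
  have hconvD : Convex ℝ (Prod.fst '' Φ) := hΦ.linear_image (LinearMap.fst ℝ W ℝ)
  have h0D : (0 : W) ∈ Prod.fst '' Φ := by
    simpa [hxu] using hdom x₀ u₀ hu₀ hx₀
  obtain ⟨z, hz⟩ := exists_linear_minorant hΦ (v := v)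
    (by
      rintro r ⟨x, u, huC, k, hk, h⟩
      simp only [Prod.mk.injEq] at h
      rw [h.2]
      have := (hv x u huC (sub_eq_zero.1 h.1.symm)).trans hk
      exact Real.toNNReal_le_iff_le_coe.1 (ENNReal.coe_le_coe.1 this))
    (fun w hw => exists_smul_mem_of_mem_span hconvD h0D
      (by
        rintro _ ⟨_, ⟨x, u, huC, k, hk, rfl⟩, rfl⟩
        obtain ⟨ε, hε, h1⟩ := hx x (hk.trans_lt ENNReal.coe_lt_top)
        obtain ⟨ε', hε', h2⟩ := hu u huC
        refine ⟨min ε ε', lt_min hε hε', ?_⟩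
        have hm : 0 ≤ min ε ε' := (lt_min hε hε').le
        -- Since `L x₀ = M u₀`, reflecting `x` and `u` through `x₀` and `u₀` reflects `L x - M u`
        -- through `0`.
        convert hdom _ _ (h2 _ hm (min_le_right _ _)) (h1 _ hm (min_le_left _ _)) using 1
        simp only [map_add, map_smul, map_sub, hxu, smul_sub]
        abel) hw)
  have hz' : ∀ x, ∀ u ∈ C, ∀ k : ℝ≥0, κ x ≤ k → v + (z (L x) - z (M u)) ≤ k := by
    intro x u huC k hk
    simpa using hz (L x - M u, (k : ℝ)) ⟨x, u, huC, k, hk, rfl⟩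
  refine ⟨z, fun x k hk => ?_, fun u huC => ?_⟩
  -- A positive gap `z (L x) - k` would grow without bound along the multiples of `x`, while `u₀`
  -- stays fixed.
  · by_contra! hlt
    obtain ⟨n, hn⟩ := exists_nat_gt ((z (M u₀) - v) / (z (L x) - k))
    have hpos : 0 < z (L x) - k := by linarith
    rw [div_lt_iff₀ hpos] at hn
    have h1 := hsmul (n + 1) (by positivity) x
    have h2 := hz' (((n + 1 : ℝ≥0)) • x) u₀ hu₀ ((n + 1) * k)
      (h1.trans (by rw [hk]; push_cast; rfl))
    rw [NNReal.smul_def, map_smul, map_smul] at h2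
    push_cast at h2
    simp only [smul_eq_mul] at h2
    nlinarith
  · have := hz' 0 u huC 0 (by simp [hκ0])
    simp only [map_zero, NNReal.coe_zero] at this
    linarith

end Algebra

/-! ### Relative interior -/

section IntrinsicInterior

variable {E : Type*} [NormedAddCommGroup E] [NormedSpace ℝ E]

/-- From a point of the relative interior one can move a little away from any point of the set. -/
theorem exists_add_smul_sub_mem_of_mem_intrinsicInterior {S : Set E} {x₀ : E}
    (hx₀ : x₀ ∈ intrinsicInterior ℝ S) {x : E} (hx : x ∈ S) :
    ∃ ε : ℝ, 0 < ε ∧ ∀ δ, 0 ≤ δ → δ ≤ ε → x₀ + δ • (x₀ - x) ∈ S := by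
  obtain ⟨y, hy, rfl⟩ := mem_intrinsicInterior.1 hx₀
  have hmem : ∀ δ : ℝ, (y : E) + δ • ((y : E) - x) ∈ affineSpan ℝ S := fun δ => by
    have := AffineSubspace.vadd_mem_of_mem_direction
      (Submodule.smul_mem _ δ (AffineSubspace.vsub_mem_direction y.2 (subset_affineSpan ℝ S hx)))
      y.2
    rwa [vadd_eq_add, add_comm] at this
  let φ : ℝ → affineSpan ℝ S := fun δ => ⟨(y : E) + δ • ((y : E) - x), hmem δ⟩
  have hφ : Continuous φ := by
    apply Continuous.subtype_mk
    fun_prop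
  have h0 : φ 0 = y := by ext; simp [φ]
  have hnhds : ∀ᶠ δ in nhds (0 : ℝ), φ δ ∈ ((↑) ⁻¹' S : Set (affineSpan ℝ S)) :=
    hφ.continuousAt.eventually_mem (by rw [h0]; exact mem_interior_iff_mem_nhds.1 hy)
  obtain ⟨ε, hε, h⟩ := Metric.eventually_nhds_iff.1 hnhds
  refine ⟨ε / 2, by positivity, fun δ h1 h2 => h (y := δ) ?_⟩
  rw [Real.dist_eq, sub_zero, abs_of_nonneg h1]
  linarith

end IntrinsicInterior

/-! ### Gauges and their polars -/

section Gauge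

variable {E F : Type*} [NormedAddCommGroup E] [InnerProductSpace ℝ E]
  [NormedAddCommGroup F] [InnerProductSpace ℝ F]

theorem IsGauge.map_add_le {κ : E → ℝ≥0∞} (hκ : IsGauge κ) (x y : E) :
    κ (x + y) ≤ κ x + κ y := by
  have h2 : (2 : ℝ≥0) ≠ 0 := two_ne_zero
  have h := hκ.convex.2 (mem_univ ((2 : ℝ≥0) • x)) (mem_univ ((2 : ℝ≥0) • y))
    (zero_le : (0 : ℝ≥0) ≤ 2⁻¹) (zero_le : (0 : ℝ≥0) ≤ 2⁻¹)
    (by rw [← two_mul, mul_inv_cancel₀ h2])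
  rw [smul_smul, smul_smul, inv_mul_cancel₀ h2, one_smul, one_smul,
    hκ.map_smul 2 two_pos, hκ.map_smul 2 two_pos, ENNReal.smul_def, ENNReal.smul_def, smul_eq_mul,
    smul_eq_mul, ← mul_assoc, ← mul_assoc, ← ENNReal.coe_mul, inv_mul_cancel₀ h2] at h
  simpa using h

/-- The sublevel sets of a gauge are convex. -/
theorem IsGauge.convex_le {κ : E → ℝ≥0∞} (hκ : IsGauge κ) (c : ℝ≥0∞) :
    Convex ℝ {x | κ x ≤ c} := by
  rw [convex_iff_forall_pos]
  intro x hx y hy a b ha hb hab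
  lift a to ℝ≥0 using ha.le
  lift b to ℝ≥0 using hb.le
  refine (hκ.map_add_le _ _).trans ?_
  have h1 := hκ.map_smul a (by exact_mod_cast ha) x
  have h2 := hκ.map_smul b (by exact_mod_cast hb) y
  rw [NNReal.smul_def] at h1 h2
  rw [h1, h2]
  calc (a : ℝ≥0∞) * κ x + b * κ y ≤ a * c + b * c := by gcongr <;> assumption
    _ = c := by rw [← add_mul, ← ENNReal.coe_add, show a + b = 1 by exact_mod_cast hab]; simp

/-- Passing to the limit in `μ` shows that a finite infimum is itself an admissible bound at points
of finite gauge, even when it is `0`. Points with `κ x = ∞` impose nothing because `μ > 0`. -/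
theorem polar_le_coe_iff {κ : E → ℝ≥0∞} {y : E} {c : ℝ≥0} :
    polar κ y ≤ c ↔ ∀ x, ∀ k : ℝ≥0, κ x = k → ⟪x, y⟫ ≤ (c : ℝ) * k := by
  constructor
  · intro h x k hk
    refine le_of_forall_pos_le_add fun ε hε => ?_
    have hlt : polar κ y < ((c + (ε / (k + 1)).toNNReal : ℝ≥0) : ℝ≥0∞) := by
      refine h.trans_lt ?_
      have : 0 < (ε / (k + 1)).toNNReal := Real.toNNReal_pos.2 (by positivity)
      exact_mod_cast lt_add_of_pos_right c this
    simp only [polar, iInf_lt_iff] at hlt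
    obtain ⟨μ, ⟨-, hμ⟩, hlt⟩ := hlt
    have h1 := hμ x
    rw [hk, ← ENNReal.coe_mul, EReal.coe_nnreal_eq_coe_real, EReal.coe_le_coe_iff] at h1
    have h2 : (μ : ℝ) ≤ c + ε / (k + 1) := by
      have : μ ≤ c + (ε / (k + 1)).toNNReal := by exact_mod_cast hlt.le
      have := NNReal.coe_le_coe.2 this
      rwa [NNReal.coe_add, Real.coe_toNNReal _ (by positivity)] at this
    have h3 : ε / ((k : ℝ) + 1) * k ≤ ε := by
      rw [div_mul_eq_mul_div, div_le_iff₀ (by positivity)]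
      nlinarith [k.2]
    push_cast at h1
    nlinarith [mul_le_mul_of_nonneg_right h2 k.2]
  · intro h
    refine ENNReal.le_of_forall_pos_le_add fun ε hε _ => ?_
    rw [← ENNReal.coe_add]
    refine iInf₂_le (c + ε) ⟨by positivity, fun x => ?_⟩
    rcases eq_or_ne (κ x) ∞ with hx | hx
    · rw [hx, ENNReal.mul_top (by exact_mod_cast (by positivity : c + ε ≠ 0))]
      simp
    · lift κ x to ℝ≥0 using hx with k hk
      rw [← ENNReal.coe_mul, EReal.coe_nnreal_eq_coe_real, EReal.coe_le_coe_iff]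
      refine (h x k hk.symm).trans ?_
      push_cast
      nlinarith [mul_nonneg ε.2 k.2, ε.coe_nonneg, k.coe_nonneg, mul_nonneg ε.coe_nonneg k.coe_nonneg]

theorem inner_le_of_polar_eq {κ : E → ℝ≥0∞} {x y : E} {c k : ℝ≥0} (hy : polar κ y = c)
    (hx : κ x = k) : ⟪x, y⟫ ≤ (c : ℝ) * k :=
  polar_le_coe_iff.1 hy.le x k hx

theorem polar_zero (κ : E → ℝ≥0∞) : polar κ 0 = 0 := by
  have : polar κ 0 ≤ ((0 : ℝ≥0) : ℝ≥0∞) := polar_le_coe_iff.2 fun x k _ => by simp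
  simpa using this

theorem polar_add_le (κ : E → ℝ≥0∞) (y z : E) : polar κ (y + z) ≤ polar κ y + polar κ z := by
  rcases eq_or_ne (polar κ y) ∞ with hy | hy
  · simp [hy]
  rcases eq_or_ne (polar κ z) ∞ with hz | hz
  · simp [hz]
  lift polar κ y to ℝ≥0 using hy with c hc
  lift polar κ z to ℝ≥0 using hz with d hd
  rw [← ENNReal.coe_add]
  refine polar_le_coe_iff.2 fun x k hk => ?_
  have h1 := inner_le_of_polar_eq hc.symm hk
  have h2 := inner_le_of_polar_eq hd.symm hk
  rw [inner_add_right]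
  push_cast
  linarith

theorem polar_smul_le (κ : E → ℝ≥0∞) {t : ℝ≥0} (ht : 0 < t) (y : E) :
    polar κ (t • y) ≤ t * polar κ y := by
  rcases eq_or_ne (polar κ y) ∞ with hy | hy
  · rw [hy, ENNReal.mul_top (by exact_mod_cast ht.ne')]
    exact le_top
  lift polar κ y to ℝ≥0 using hy with c hc
  rw [← ENNReal.coe_mul]
  refine polar_le_coe_iff.2 fun x k hk => ?_
  rw [NNReal.smul_def, real_inner_smul_right]
  push_cast
  rw [mul_assoc]
  exact mul_le_mul_of_nonneg_left (inner_le_of_polar_eq hc.symm hk) t.coe_nonneg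

/-- A linear function bounded by `s` on the sublevel set at height `σ > 0` of a gauge is dominated
by the gauge multiplied by `s / σ`. -/
theorem IsGauge.polar_le_of_forall_inner_le {κ : E → ℝ≥0∞} (hκ : IsGauge κ) {σ s : ℝ≥0}
    (hσ : 0 < σ) {y : E} (h : ∀ x, κ x ≤ σ → ⟪x, y⟫ ≤ s) : polar κ y ≤ (s / σ : ℝ≥0) := by
  refine polar_le_coe_iff.2 fun x k hk => ?_
  have hσ' : (0 : ℝ) < σ := hσ
  rcases eq_or_ne k 0 with rfl | hk0
  -- All positive multiples of `x` lie in the sublevel set, so `⟪x, y⟫` cannot be positive.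
  · simp only [NNReal.coe_zero, mul_zero]
    by_contra! hlt
    obtain ⟨n, hn⟩ := exists_nat_gt ((s : ℝ) / ⟪x, y⟫)
    rw [div_lt_iff₀ hlt] at hn
    have h1 := h ((n + 1 : ℝ≥0) • x) (by rw [hκ.map_smul _ (by positivity), hk]; simp)
    rw [NNReal.smul_def, real_inner_smul_left] at h1
    push_cast at h1
    linarith
  · have hk' : 0 < k := pos_iff_ne_zero.2 hk0
    have hk'' : (0 : ℝ) < k := hk'
    have h1 := h ((σ / k) • x) (by
      rw [hκ.map_smul _ (by positivity), hk, ← ENNReal.coe_mul, div_mul_cancel₀ _ hk0])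
    rw [NNReal.smul_def, real_inner_smul_left] at h1
    push_cast at h1 ⊢
    rw [div_mul_eq_mul_div, le_div_iff₀ hσ']
    rw [div_mul_eq_mul_div, div_le_iff₀ hk''] at h1
    linarith

/-! ### Separation and bipolar theorems -/

theorem exists_inner_separation [CompleteSpace E] {S : Set E} (hS : Convex ℝ S)
    (hcl : IsClosed S) {x : E} (hx : x ∉ S) :
    ∃ (w : E) (α : ℝ), ⟪x, w⟫ < α ∧ ∀ u ∈ S, α < ⟪u, w⟫ := by
  obtain ⟨f, α, h1, h2⟩ := geometric_hahn_banach_point_closed hS hcl hx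
  refine ⟨(InnerProductSpace.toDual ℝ E).symm f, α, ?_, fun u hu => ?_⟩
  · rw [real_inner_comm, InnerProductSpace.toDual_symm_apply]; exact h1
  · rw [real_inner_comm, InnerProductSpace.toDual_symm_apply]; exact h2 u hu

/-- A point dominated by the polar of a closed gauge has gauge at most one. -/
theorem IsClosedGauge.le_one_of_inner_le_polar [CompleteSpace E] {κ : E → ℝ≥0∞}
    (hκ : IsClosedGauge κ) {x : E} (h : ∀ w, ∀ c : ℝ≥0, polar κ w = c → ⟪w, x⟫ ≤ c) :
    κ x ≤ 1 := by
  by_contra hx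
  obtain ⟨w, α, h1, h2⟩ := exists_inner_separation (hκ.1.convex_le 1)
    (hκ.2.isClosed_preimage 1) (x := x) hx
  -- The origin lies in the sublevel set. Hence `-w` is bounded there by `-α > 0`, so its polar is
  -- at most `-α`, whereas `⟪-w, x⟫ > -α`.
  have hα : α < 0 := by
    simpa using h2 0 (by simp [hκ.1.map_zero])
  have hp : polar κ (-w) ≤ ((-α).toNNReal / 1 : ℝ≥0) :=
    hκ.1.polar_le_of_forall_inner_le one_pos fun u hu => by
      rw [Real.coe_toNNReal _ (by linarith), inner_neg_right]
      linarith [h2 u (by simpa using hu)]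
  have hfin : polar κ (-w) ≠ ∞ := (hp.trans_lt ENNReal.coe_lt_top).ne
  have h3 := h (-w) _ (ENNReal.coe_toNNReal hfin).symm
  have h4 : ((polar κ (-w)).toNNReal : ℝ) ≤ -α := by
    rw [← ENNReal.coe_toNNReal hfin, ENNReal.coe_le_coe, div_one] at hp
    have := NNReal.coe_le_coe.2 hp
    rwa [Real.coe_toNNReal _ (by linarith)] at this
  rw [inner_neg_left, real_inner_comm] at h3
  linarith

/-- The bipolar theorem for antipolars: for a nonempty closed convex set avoiding the origin, the
second antipolar consists of the multiples by scalars at least one. -/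
theorem exists_smul_of_mem_antipolar_antipolar [FiniteDimensional ℝ E] {C : Set E}
    (hC : Convex ℝ C) (hcl : IsClosed C) (h0 : (0 : E) ∉ C) {w : E}
    (hw : w ∈ antipolar (antipolar C)) : ∃ t : ℝ, 1 ≤ t ∧ t⁻¹ • w ∈ C := by
  by_contra! hne
  -- As `0 ∉ C`, only `s > 0` occurs, and `R` is the union of the multiples of `C` by scalars at
  -- least one. Allowing `s = 0` keeps the range of `s` compact, which makes `R` closed.
  let R : Set E := {w | ∃ s : ℝ, 0 ≤ s ∧ s ≤ 1 ∧ s • w ∈ C}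
  have hRconv : Convex ℝ R := by
    rw [convex_iff_forall_pos]
    rintro x ⟨s, hs0, hs1, hs⟩ y ⟨t, ht0, ht1, ht⟩ a b ha hb hab
    have hs0 : 0 < s := lt_of_le_of_ne hs0 (by rintro rfl; simp [h0] at hs)
    have ht0 : 0 < t := lt_of_le_of_ne ht0 (by rintro rfl; simp [h0] at ht)
    have hD : 0 < a * t + b * s := by positivity
    refine ⟨s * t / (a * t + b * s), by positivity, ?_, ?_⟩
    · rw [div_le_one hD]
      nlinarith [mul_nonneg hb.le hs0.le, mul_nonneg ha.le ht0.le,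
        mul_nonneg (mul_nonneg ha.le ht0.le) (sub_nonneg.2 hs1),
        mul_nonneg (mul_nonneg hb.le hs0.le) (sub_nonneg.2 ht1),
        mul_pos hs0 ht0, show s * t = (a + b) * (s * t) by rw [hab, one_mul]]
    · have := hC hs ht (a := a * t / (a * t + b * s)) (b := b * s / (a * t + b * s))
        (by positivity) (by positivity) (by field_simp)
      convert this using 1
      simp only [smul_add, smul_smul]
      congr 2 <;> ring
  have hRcl : IsClosed R := by
    have : R = Prod.snd '' ((fun p : Icc (0 : ℝ) 1 × E => (p.1 : ℝ) • p.2) ⁻¹' C) := by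
      ext x
      simp only [R, mem_ofPred_eq, mem_image, mem_preimage, Prod.exists, exists_eq_right,
        Subtype.exists, mem_Icc, exists_prop, and_assoc]
    rw [this]
    exact isClosedMap_snd_of_compactSpace _ (hcl.preimage (by fun_prop))
  have hwR : w ∉ R := by
    rintro ⟨s, hs0, hs1, hs⟩
    have hs0 : 0 < s := lt_of_le_of_ne hs0 (by rintro rfl; simp [h0] at hs)
    refine hne s⁻¹ ((one_le_inv₀ hs0).2 hs1) (by simpa using hs)
  have := FiniteDimensional.complete ℝ E
  obtain ⟨y, α, h1, h2⟩ := exists_inner_separation hRconv hRcl hwR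
  obtain ⟨y₁, β, h3, h4⟩ := exists_inner_separation hC hcl h0
  rw [inner_zero_left] at h3
  have hnn : ∀ u ∈ C, 0 ≤ ⟪u, y⟫ := by
    intro u hu
    by_contra! hlt
    obtain ⟨n, hn⟩ := exists_nat_gt (α / ⟪u, y⟫)
    have h5 := h2 ((n + 1 : ℝ) • u) ⟨(n + 1 : ℝ)⁻¹, by positivity,
      inv_le_one_of_one_le₀ (by linarith [n.cast_nonneg (α := ℝ)]), by
        rwa [smul_smul, inv_mul_cancel₀ (by positivity), one_smul]⟩
    rw [real_inner_smul_left] at h5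
    rw [div_lt_iff_of_neg hlt] at hn
    linarith
  -- If `⟪w, y⟫ < 0`, `α` may fail to be positive and `y` cannot be rescaled; instead a large
  -- multiple of `y`, nonnegative on `C`, is added to the antipolar point `β⁻¹ • y₁`. Otherwise `α >
  -- 0` and `α⁻¹ • y` suffices.
  by_cases hwy : ⟪w, y⟫ < 0
  · obtain ⟨n, hn⟩ := exists_nat_gt (⟪w, β⁻¹ • y₁⟫ / -⟪w, y⟫)
    rw [div_lt_iff₀ (by linarith)] at hn
    have h5 := hw (β⁻¹ • y₁ + (n : ℝ) • y) fun u hu => by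
      rw [real_inner_comm, inner_add_right, real_inner_smul_right, real_inner_smul_right]
      have := mul_nonneg n.cast_nonneg (hnn u hu)
      have : 1 ≤ β⁻¹ * ⟪u, y₁⟫ := by
        rw [← inv_mul_cancel₀ h3.ne']
        exact mul_le_mul_of_nonneg_left (h4 u hu).le (by positivity)
      linarith
    rw [inner_add_right, real_inner_smul_right (y := y)] at h5
    linarith
  · have hα : 0 < α := by linarith
    have h5 := hw (α⁻¹ • y) fun u hu => by
      rw [real_inner_comm, real_inner_smul_right, ← inv_mul_cancel₀ hα.ne']
      exact mul_le_mul_of_nonneg_left (h2 u ⟨1, zero_le_one, le_rfl, by simpa using hu⟩).le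
        (by positivity)
    rw [real_inner_smul_right, inv_mul_eq_div, le_div_iff₀ hα] at h5
    linarith

/-! ### Residual set, its antipolar and weak duality -/

theorem convex_antipolar (C : Set E) : Convex ℝ (antipolar C) := by
  intro y hy z hz a b ha hb hab x hx
  rw [inner_add_left, real_inner_smul_left, real_inner_smul_left]
  nlinarith [mul_le_mul_of_nonneg_left (hy x hx) ha, mul_le_mul_of_nonneg_left (hz x hx) hb]

theorem IsGauge.convex_residualSet {ρ : F → ℝ≥0∞} (hρ : IsGauge ρ) (b : F) (σ : ℝ≥0) :
    Convex ℝ (residualSet ρ b σ) := by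
  intro x hx y hy s t hs ht hst
  have := hρ.convex_le σ hx hy hs ht hst
  have he : b - (s • x + t • y) = s • (b - x) + t • (b - y) := by
    rw [smul_sub, smul_sub, sub_add_sub_comm, ← add_smul, hst, one_smul]
  change ρ (b - (s • x + t • y)) ≤ σ
  rwa [he]

theorem IsClosedGauge.isClosed_residualSet {ρ : F → ℝ≥0∞} (hρ : IsClosedGauge ρ) (b : F)
    (σ : ℝ≥0) : IsClosed (residualSet ρ b σ) :=
  (hρ.2.isClosed_preimage (σ : ℝ≥0∞)).preimage (continuous_const.sub continuous_id)

/-- The feasible set of the gauge dual problem is the antipolar of the residual set. -/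
theorem IsGauge.dualFeasible_eq_antipolar {ρ : F → ℝ≥0∞} (hρ : IsGauge ρ) (b : F) (σ : ℝ≥0)
    (hzero : σ = 0 → ρ ⁻¹' {0} = {0}) :
    dualFeasible ρ b σ = antipolar (residualSet ρ b σ) := by
  have hfin : ∀ y, ∀ r : ℝ≥0, σ * polar ρ y = r →
      (y ∈ dualFeasible ρ b σ ↔ 1 ≤ ⟪b, y⟫ - r) := by
    intro y r hr
    rw [dualFeasible, mem_ofPred_eq, hr, EReal.coe_nnreal_eq_coe_real, ← EReal.coe_sub,
      ← EReal.coe_one, EReal.coe_le_coe_iff]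
  ext y
  rcases eq_or_ne σ 0 with rfl | hσ
  -- Here `0 * ∞ = 0`, so the polar term vanishes whatever its value, and `C₀ = {b}`.
  · rw [hfin y 0 (by simp)]
    have hC : residualSet ρ b 0 = {b} := by
      ext u
      have : ρ (b - u) = 0 ↔ b - u = 0 := Set.ext_iff.1 (hzero rfl) (b - u)
      simp only [residualSet, mem_ofPred_eq, ENNReal.coe_zero, nonpos_iff_eq_zero, this,
        sub_eq_zero, mem_singleton_iff, eq_comm]
    simp [antipolar, hC, real_inner_comm]
  have hσ' : 0 < σ := pos_iff_ne_zero.2 hσ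
  constructor
  · intro hy u hu
    rcases eq_or_ne (polar ρ y) ∞ with ht | ht
    · rw [dualFeasible, mem_ofPred_eq, ht, ENNReal.mul_top (by exact_mod_cast hσ)] at hy
      exact absurd (le_bot_iff.1 (by simpa using hy)) (EReal.coe_ne_bot 1)
    have hc := (ENNReal.coe_toNNReal ht).symm
    set c := (polar ρ y).toNNReal
    have h1 := (hfin y (σ * c) (by rw [hc]; push_cast; rfl)).1 hy
    have hu : ρ (b - u) ≤ σ := hu
    have hr := (ENNReal.coe_toNNReal (hu.trans_lt ENNReal.coe_lt_top).ne).symm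
    have h2 := inner_le_of_polar_eq hc hr
    rw [hr, ENNReal.coe_le_coe] at hu
    have h3 : ((ρ (b - u)).toNNReal : ℝ) ≤ σ := hu
    rw [inner_sub_left] at h2
    push_cast at h1
    rw [real_inner_comm]
    nlinarith [mul_le_mul_of_nonneg_left h3 c.coe_nonneg]
  · intro hy
    have hb : 1 ≤ ⟪b, y⟫ := by
      rw [real_inner_comm]
      exact hy b (by simp [residualSet, hρ.map_zero])
    have hs : ((⟪b, y⟫ - 1).toNNReal : ℝ) = ⟪b, y⟫ - 1 := Real.coe_toNNReal _ (by linarith)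
    have hp := hρ.polar_le_of_forall_inner_le (s := (⟪b, y⟫ - 1).toNNReal) hσ' (y := y)
      fun x hx => by
        have := hy (b - x) (by simpa [residualSet] using hx)
        rw [real_inner_comm, inner_sub_left] at this
        rw [hs]
        linarith
    have hc := (ENNReal.coe_toNNReal (hp.trans_lt ENNReal.coe_lt_top).ne).symm
    set c := (polar ρ y).toNNReal
    rw [hc, ENNReal.coe_le_coe, le_div_iff₀ hσ'] at hp
    rw [hfin y (σ * c) (by rw [hc]; push_cast; rfl)]
    have := NNReal.coe_le_coe.2 hp
    push_cast at this ⊢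
    linarith

variable [FiniteDimensional ℝ E] [FiniteDimensional ℝ F]

/-- Weak gauge duality. -/
theorem inv_polar_adjoint_le {κ : E → ℝ≥0∞} {ρ : F → ℝ≥0∞} {A : E →ₗ[ℝ] F} {b : F} {σ : ℝ≥0}
    {x : E} (hx : x ∈ primalFeasible A ρ b σ) {y : F} (hy : y ∈ antipolar (residualSet ρ b σ)) :
    (polar κ (LinearMap.adjoint A y))⁻¹ ≤ κ x := by
  rcases eq_or_ne (κ x) ∞ with hk | hk
  · simp [hk]
  rcases eq_or_ne (polar κ (LinearMap.adjoint A y)) ∞ with hc | hc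
  · simp [hc]
  have h1 := inner_le_of_polar_eq (ENNReal.coe_toNNReal hc).symm (ENNReal.coe_toNNReal hk).symm
  rw [LinearMap.adjoint_inner_right, real_inner_comm] at h1
  have h2 := (hy (A x) hx).trans h1
  rw [ENNReal.inv_le_iff_le_mul (fun h => absurd h hk) (fun h => absurd h hc),
    ← ENNReal.coe_toNNReal hc, ← ENNReal.coe_toNNReal hk]
  exact_mod_cast h2

end Gauge

end GaugeDuality

/-! ### Strong duality -/

theorem mainTheorem3 {E F : Type*}
    [NormedAddCommGroup E] [InnerProductSpace ℝ E] [FiniteDimensional ℝ E]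
    [NormedAddCommGroup F] [InnerProductSpace ℝ F] [FiniteDimensional ℝ F]
    (κ : E → ℝ≥0∞) (ρ : F → ℝ≥0∞) (A : E →ₗ[ℝ] F) (b : F) (σ : ℝ≥0)
    (hκ : GaugeDuality.IsClosedGauge κ) (hρ : GaugeDuality.IsClosedGauge ρ)
    (hσ : (σ : ℝ≥0∞) < ρ b)
    (hρ_zero : σ = 0 → ρ ⁻¹' {0} = {0})
    (hprimal : (intrinsicInterior ℝ (GaugeDuality.dom κ) ∩
      A ⁻¹' intrinsicInterior ℝ (GaugeDuality.residualSet ρ b σ)).Nonempty)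
    (hdual : (intrinsicInterior ℝ (GaugeDuality.dom (GaugeDuality.polar κ)) ∩
      LinearMap.adjoint A '' intrinsicInterior ℝ
        (GaugeDuality.antipolar (GaugeDuality.residualSet ρ b σ))).Nonempty) :
    (∃ x ∈ GaugeDuality.primalFeasible A ρ b σ,
      κ x = GaugeDuality.primalValue κ A ρ b σ) ∧
    (∃ y ∈ GaugeDuality.dualFeasible ρ b σ,
      GaugeDuality.polar κ (LinearMap.adjoint A y) = GaugeDuality.dualValue κ A ρ b σ) ∧
    GaugeDuality.primalValue κ A ρ b σ * GaugeDuality.dualValue κ A ρ b σ = 1 := by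
  have hE := FiniteDimensional.complete ℝ E
  have hF := FiniteDimensional.complete ℝ F
  rw [show GaugeDuality.dualValue κ A ρ b σ = ⨅ y ∈ GaugeDuality.dualFeasible ρ b σ,
    GaugeDuality.polar κ (LinearMap.adjoint A y) from rfl,
    hρ.1.dualFeasible_eq_antipolar b σ hρ_zero]
  set C := GaugeDuality.residualSet ρ b σ with hC
  have hCconv : Convex ℝ C := hρ.1.convex_residualSet b σ
  have h0C : (0 : F) ∉ C := by simpa [hC, GaugeDuality.residualSet] using hσ
  set p := GaugeDuality.primalValue κ A ρ b σ with hp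
  set d := ⨅ y ∈ GaugeDuality.antipolar C, GaugeDuality.polar κ (LinearMap.adjoint A y) with hd
  have hple : ∀ x, A x ∈ C → p ≤ κ x := fun x hx => iInf₂_le x hx
  have hdle : ∀ y ∈ GaugeDuality.antipolar C,
      d ≤ GaugeDuality.polar κ (LinearMap.adjoint A y) := fun y hy => iInf₂_le y hy
  have hweak : d⁻¹ ≤ p := le_iInf₂ fun x hx => by
    rw [ENNReal.inv_le_iff_inv_le]
    exact le_iInf₂ fun y hy => by
      rw [ENNReal.inv_le_iff_inv_le]
      exact GaugeDuality.inv_polar_adjoint_le hx hy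
  obtain ⟨x₀, hx₀, hAx₀⟩ := hprimal
  obtain ⟨_, hw₀, y₀, hy₀, rfl⟩ := hdual
  have hx₀f : x₀ ∈ GaugeDuality.dom κ := intrinsicInterior_subset hx₀
  have hw₀f : LinearMap.adjoint A y₀ ∈ GaugeDuality.dom (GaugeDuality.polar κ) :=
    intrinsicInterior_subset hw₀
  have hpfin : p ≠ ∞ := ((hple x₀ (intrinsicInterior_subset hAx₀)).trans_lt hx₀f).ne
  have hdfin : d ≠ ∞ := ((hdle y₀ (intrinsicInterior_subset hy₀)).trans_lt hw₀f).ne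
  have hp0 : p ≠ 0 := fun h => hdfin (by simpa [h] using hweak)
  have hd0 : d ≠ 0 := fun h => hpfin (by simpa [h] using hweak)
  have hpr : 0 < p.toReal := ENNReal.toReal_pos hp0 hpfin
  have hdr : 0 < d.toReal := ENNReal.toReal_pos hd0 hdfin
  have hdual_attained : ∃ y ∈ GaugeDuality.antipolar C,
      GaugeDuality.polar κ (LinearMap.adjoint A y) ≤ p⁻¹ := by
    obtain ⟨f, hf1, hf2⟩ := GaugeDuality.exists_linear_separation hκ.1.map_zero hκ.1.map_add_le
      (fun t ht x => (hκ.1.map_smul t ht x).le) hCconv A LinearMap.id hx₀f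
      (intrinsicInterior_subset hAx₀) rfl
      (fun x hx => GaugeDuality.exists_add_smul_sub_mem_of_mem_intrinsicInterior hx₀ hx)
      (fun u hu => GaugeDuality.exists_add_smul_sub_mem_of_mem_intrinsicInterior hAx₀ hu)
      (v := p.toReal) (fun x u hu hxu => by
        rw [ENNReal.ofReal_toReal hpfin]
        exact hple x (by rwa [hxu]))
    set z := (InnerProductSpace.toDual ℝ F).symm f.toContinuousLinearMap with hz
    have hzf : ∀ u, ⟪z, u⟫ = f u := fun u => InnerProductSpace.toDual_symm_apply
    refine ⟨p.toReal⁻¹ • z, fun u hu => ?_, ?_⟩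
    · rw [real_inner_smul_left, hzf, ← inv_mul_cancel₀ hpr.ne']
      exact mul_le_mul_of_nonneg_left (hf2 u hu) (by positivity)
    · have hpinv : p⁻¹ = ((p.toNNReal⁻¹ : ℝ≥0) : ℝ≥0∞) := by
        rw [ENNReal.coe_inv (ENNReal.toNNReal_ne_zero.2 ⟨hp0, hpfin⟩), ENNReal.coe_toNNReal hpfin]
      rw [hpinv, GaugeDuality.polar_le_coe_iff]
      intro x k hk
      rw [LinearMap.adjoint_inner_right, real_inner_comm, real_inner_smul_left, hzf]
      exact mul_le_mul_of_nonneg_left (hf1 x k hk) (by positivity)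
  have hprimal_attained : ∃ x, A x ∈ C ∧ κ x ≤ d⁻¹ := by
    obtain ⟨f, hf1, hf2⟩ := GaugeDuality.exists_linear_separation (GaugeDuality.polar_zero κ)
      (GaugeDuality.polar_add_le κ) (fun t ht x => GaugeDuality.polar_smul_le κ ht x)
      (GaugeDuality.convex_antipolar C) LinearMap.id (LinearMap.adjoint A) hw₀f
      (intrinsicInterior_subset hy₀) rfl
      (fun x hx => GaugeDuality.exists_add_smul_sub_mem_of_mem_intrinsicInterior hw₀ hx)
      (fun u hu => GaugeDuality.exists_add_smul_sub_mem_of_mem_intrinsicInterior hy₀ hu)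
      (v := d.toReal) (fun w y hy hwy => by
        rw [ENNReal.ofReal_toReal hdfin, show w = LinearMap.adjoint A y from hwy]
        exact hdle y hy)
    set x := (InnerProductSpace.toDual ℝ E).symm f.toContinuousLinearMap with hx
    have hxf : ∀ w, ⟪x, w⟫ = f w := fun w => InnerProductSpace.toDual_symm_apply
    have hx1 : κ x ≤ 1 := hκ.le_one_of_inner_le_polar fun w c hc => by
      rw [real_inner_comm, hxf]
      exact hf1 w c hc
    -- `A (x / d)` lies in `C''`, so dividing by some `t ≥ 1` brings it into `C`; this can only
    -- decrease `κ`.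
    obtain ⟨t, ht, htC⟩ := GaugeDuality.exists_smul_of_mem_antipolar_antipolar hCconv
      (hρ.isClosed_residualSet b σ) h0C (w := A (d.toReal⁻¹ • x)) fun y hy => by
        rw [← LinearMap.adjoint_inner_right, real_inner_smul_left, hxf, ← inv_mul_cancel₀ hdr.ne']
        exact mul_le_mul_of_nonneg_left (hf2 y hy) (by positivity)
    have hdn : 0 < d.toNNReal := pos_iff_ne_zero.2 (ENNReal.toNNReal_ne_zero.2 ⟨hd0, hdfin⟩)
    lift t to ℝ≥0 using by linarith
    have ht1 : 1 ≤ t := by exact_mod_cast ht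
    refine ⟨(t⁻¹ * d.toNNReal⁻¹) • x, ?_, ?_⟩
    · rw [← map_smul] at htC
      convert htC using 2
      rw [mul_smul]
      rfl
    · rw [hκ.1.map_smul _ (by positivity)]
      calc ((t⁻¹ * d.toNNReal⁻¹ : ℝ≥0) : ℝ≥0∞) * κ x ≤ ((1 * d.toNNReal⁻¹ : ℝ≥0) : ℝ≥0∞) * 1 := by
            gcongr
            exact inv_le_one_of_one_le₀ ht1
        _ = d⁻¹ := by
            rw [one_mul, mul_one, ENNReal.coe_inv hdn.ne', ENNReal.coe_toNNReal hdfin]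
  obtain ⟨x, hxC, hx⟩ := hprimal_attained
  obtain ⟨y, hyC, hy⟩ := hdual_attained
  have hpd : p = d⁻¹ := le_antisymm ((hple x hxC).trans hx) hweak
  have hdp : p⁻¹ = d := by rw [hpd, inv_inv]
  refine ⟨⟨x, hxC, le_antisymm (hx.trans hweak) (hple x hxC)⟩,
    ⟨y, hyC, le_antisymm (hy.trans hdp.le) (hdle y hyC)⟩, ?_⟩
  rw [hpd, ENNReal.inv_mul_cancel hd0 hdfin]
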